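/- Let $K$ be a field of characteristic $0$ (for instance $K=\mathbb R$ or $K=\mathbb C$). Call a sequence $x$ of elements of $K$, indexed by $n\in\mathbb N=\{0,1,2,\dots\}$, *hypergeometric* if there is a rational function $r\in K(t)$ such that $x(n+1)=r(n)\,x(n)$ for all large enough $n\in\mathbb N$. Let $N\ge 3$ be an integer and let $(s_n)_{n\in\mathbb N}$ be a sequence in $K$. Then $(s_n)$ is hypergeometric and satisfies $$s_n=s_{n-1}+\frac{2}{n-2}\,s_{n-3}+2\qquad\text{for all } n\ge N$$ if and only if there is $a^*\in K$ such that $$s_n=a^*(n^2+7n+6)-2(n+1)\qquad\text{for all } n\ge N-3.$$ In particular (case $N=3$), the recurrence has no hypergeometric solutions other than those of the quadratic family $a^*(n^2+7n+6)-2(n+1)$. -/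

import Mathlib

/-- The sequence `s` satisfies `s_n = s_{n-1} + 2 / (n-2) * s_{n-3} + 2` for every `n ≥ N`.
It is used only for `N ≥ 3`, so that the indices `n - 1`, `n - 3` are genuine natural numbers and
the denominator `n - 2` is not zero. -/
def SolvesRecurrenceFrom {K : Type*} [Field K] (N : ℕ) (s : ℕ → K) : Prop :=
  ∀ n : ℕ, N ≤ n → s n = s (n - 1) + 2 / ((n : K) - 2) * s (n - 3) + 2

/-- The sequence `x` is hypergeometric: there is a rational function `r` over `K` such that
`x (n + 1) = r n * x n` for all large enough natural numbers `n`. (In characteristic zero the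
denominator of `r` does not vanish at large `n`, so the evaluation there is the genuine one.) -/
def IsHypergeometric {K : Type*} [Field K] (x : ℕ → K) : Prop :=
  ∃ r : RatFunc K, ∀ᶠ n : ℕ in Filter.atTop,
    x (n + 1) = r.eval (RingHom.id K) (n : K) * x n

open Polynomial Filter

/-! Substituting the hypergeometric ratio into the recurrence leaves one linear equation for `s n`
over `K(n)`; the inhomogeneous term makes it nondegenerate, so `s` is eventually a reduced fraction
`A / B` (`exists_coprime`). Clearing denominators gives `B ∣ B(t+2) B(t+3)`, which makes `B`
constant, since a root would generate infinitely many others. Leading coefficients then bound the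
degree of the resulting polynomial by 2, and two evaluations leave one free parameter. Finally the
recurrence, run backwards, carries eventual equality down to `N - 3`. -/

theorem Polynomial.coeff_taylor_natDegree_pred {K : Type*} [Field K] (p : K[X]) {d : ℕ} (hd : p.natDegree = d + 1)
    (r : K) : (taylor r p).coeff d = p.coeff d + (d + 1) * p.coeff (d + 1) * r := by
  rw [taylor_coeff, eval_eq_sum_range' (n := 2)]
  · simp [Finset.sum_range_succ, hasseDeriv_coeff, add_comm 1 d]
  · have := natDegree_hasseDeriv_le p d
    omega

section EventualPolynomials

variable {K : Type*} [Field K] [CharZero K]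

theorem Polynomial.eventually_eval_natCast_ne_zero {p : K[X]} (hp : p ≠ 0) :
    ∀ᶠ n : ℕ in atTop, p.eval (n : K) ≠ 0 := by
  classical
  have hfin : {n : ℕ | p.eval (n : K) = 0}.Finite := by
    refine Set.Finite.subset
      (Set.Finite.preimage (Nat.cast_injective (R := K)).injOn p.roots.toFinset.finite_toSet) ?_
    intro n hn
    simpa [hp] using hn
  rw [← Nat.cofinite_eq_atTop]
  exact hfin.eventually_cofinite_notMem

theorem Polynomial.eq_of_eventually_eval_natCast_eq {p q : K[X]}
    (h : ∀ᶠ n : ℕ in atTop, p.eval (n : K) = q.eval (n : K)) : p = q := by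
  by_contra hne
  obtain ⟨n, hn, hn'⟩ :=
    (h.and (eventually_eval_natCast_ne_zero (sub_ne_zero.mpr hne))).exists
  exact hn' (by simp [hn])

/-- A polynomial dividing the product of two of its own shifts in the same direction is constant. -/
theorem Polynomial.natDegree_eq_zero_of_dvd_taylor_mul_taylor {q : K[X]} (hq : q ≠ 0) {a b : ℕ}
    (ha : 0 < a) (hb : 0 < b) (h : q ∣ taylor (a : K) q * taylor (b : K) q) :
    q.natDegree = 0 := by
  by_contra hdeg
  obtain ⟨α, hα⟩ := IsAlgClosed.exists_aeval_eq_zero (AlgebraicClosure K) q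
    (fun h0 => hdeg (natDegree_eq_of_degree_eq_some h0))
  have step : ∀ x : AlgebraicClosure K, aeval x q = 0 →
      aeval (x + a) q = 0 ∨ aeval (x + b) q = 0 := by
    intro x hx
    obtain ⟨c, hc⟩ := h
    have h1 := congrArg (aeval x) hc
    simpa [taylor_apply, aeval_comp, hx] using h1
  have hfin : {k : ℕ | aeval (α + k) q = 0}.Finite := by
    have hinj : Function.Injective (fun k : ℕ => α + (k : AlgebraicClosure K)) :=
      (add_right_injective α).comp Nat.cast_injective
    refine Set.Finite.subset
      (Set.Finite.preimage hinj.injOn (q.rootSet_finite (AlgebraicClosure K))) ?_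
    intro k hk
    exact (mem_rootSet.mpr ⟨hq, hk⟩)
  -- The last root on the ray `α + ℕ` would still force a root `a` or `b` further along.
  obtain ⟨m, hm, hmax⟩ := hfin.exists_maximal ⟨0, by simpa using hα⟩
  rcases step _ hm with h1 | h1
  · have := @hmax (m + a) (by simpa [add_assoc] using h1) (by simp)
    simp at this; omega
  · have := @hmax (m + b) (by simpa [add_assoc] using h1) (by simp)
    simp at this; omega

/-- The polynomial solutions of the recurrence, with denominators cleared. -/
theorem Polynomial.exists_eval_eq_of_recurrence {p : K[X]}
    (h : (X + 1) * (taylor 3 p - taylor 2 p) = 2 * p + 2 * (X + 1)) :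
    ∃ a : K, ∀ t : K, p.eval t = a * (t ^ 2 + 7 * t + 6) - 2 * (t + 1) := by
  have hdeg : p.natDegree ≤ 2 := by
    by_contra hlt
    obtain ⟨d, hd⟩ : ∃ d, p.natDegree = d + 1 := ⟨p.natDegree - 1, by omega⟩
    have hlead : p.coeff (d + 1) ≠ 0 := by
      rw [← hd, coeff_natDegree, leadingCoeff_ne_zero]
      rintro rfl
      simp at hd
    have htop : ∀ r : K, (taylor r p).coeff (d + 1) = p.coeff (d + 1) := fun r => by
      rw [← hd, coeff_taylor_natDegree, coeff_natDegree]
    -- With leading coefficient `c`, the difference of shifts has coefficient `(d + 1) * c * (3 -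
    -- 2)` in degree `d`, so the top coefficients give `(d + 1) * c = 2 * c`.
    have hc := congrArg (fun f => coeff f (d + 1)) h
    have h1 : (1 : K[X]).coeff (d + 1) = 0 := by simp [coeff_one]
    have hX : (X : K[X]).coeff (d + 1) = 0 := coeff_X_of_ne_one (by omega)
    have h2 : ∀ f : K[X], (2 * f).coeff (d + 1) = 2 * f.coeff (d + 1) := fun f => by
      rw [two_mul, two_mul, coeff_add]
    simp only [add_mul, one_mul, coeff_add, coeff_X_mul, coeff_sub, htop, h2, h1, hX,
      coeff_taylor_natDegree_pred p hd] at hc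
    have h3 : ((d : K) - 1) * p.coeff (d + 1) = 0 := by linear_combination hc
    rcases mul_eq_zero.mp h3 with h4 | h4
    · have : d = 1 := by exact_mod_cast sub_eq_zero.mp h4
      omega
    · exact hlead h4
  have heval : ∀ t : K, p.eval t = p.coeff 0 + p.coeff 1 * t + p.coeff 2 * t ^ 2 := fun t => by
    rw [eval_eq_sum_range' (n := 3) (by omega)]
    simp [Finset.sum_range_succ]
  have hrec : ∀ t : K, (t + 1) * (p.eval (t + 3) - p.eval (t + 2)) = 2 * p.eval t + 2 * (t + 1) :=
    fun t => by simpa [taylor_eval] using congrArg (eval t) h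
  have e0 := hrec 0
  -- At `-1` the factor `t + 1` vanishes, leaving `p(-1) = 0`.
  have e1 := hrec (-1)
  simp only [heval] at e0 e1
  refine ⟨p.coeff 2, fun t => ?_⟩
  have h2 : (2 : K) ≠ 0 := two_ne_zero
  have c01 : p.coeff 1 = p.coeff 0 + p.coeff 2 := by
    apply mul_left_cancel₀ h2
    linear_combination e1
  have c0 : p.coeff 0 = 6 * p.coeff 2 - 2 := by
    linear_combination -e0 + c01
  rw [heval, c01, c0]
  ring

end EventualPolynomials

section Recurrence

variable {K : Type*} [Field K] [CharZero K]

theorem SolvesRecurrenceFrom.mul_eq {N : ℕ} {s : ℕ → K} (hs : SolvesRecurrenceFrom N s) {n : ℕ}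
    (hn : N ≤ n + 3) :
    ((n : K) + 1) * (s (n + 3) - s (n + 2)) = 2 * s n + 2 * ((n : K) + 1) := by
  have h := hs (n + 3) hn
  have hne : (n : K) + 1 ≠ 0 := Nat.cast_add_one_ne_zero n
  have hc : ((n + 3 : ℕ) : K) - 2 = n + 1 := by push_cast; ring
  simp only [Nat.add_sub_cancel, hc, show n + 3 - 1 = n + 2 by omega] at h
  rw [h]
  field_simp
  ring

/-- The coefficient of `s n` in the cleared recurrence is the nonzero constant 2, so `s (n + 2)` and
`s (n + 3)` determine `s n`. -/
theorem SolvesRecurrenceFrom.eq_of_eventuallyEq {N : ℕ} {s u : ℕ → K}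
    (hs : SolvesRecurrenceFrom N s) (hu : SolvesRecurrenceFrom N u)
    (h : ∀ᶠ n in atTop, s n = u n) : ∀ n, N - 3 ≤ n → s n = u n := by
  obtain ⟨M, hM⟩ := eventually_atTop.mp h
  have key : ∀ k n, N - 3 ≤ n → M ≤ n + k → s n = u n := by
    intro k
    induction k with
    | zero => exact fun n _ hn => hM n hn
    | succ k ih =>
      intro n hn hk
      have e1 := hs.mul_eq (n := n) (by omega)
      have e2 := hu.mul_eq (n := n) (by omega)
      rw [ih (n + 3) (by omega) (by omega), ih (n + 2) (by omega) (by omega)] at e1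
      apply mul_left_cancel₀ (two_ne_zero (α := K))
      linear_combination e2 - e1
  exact fun n hn => key M n hn (by omega)

theorem solvesRecurrenceFrom_of_eq_quadratic {N : ℕ} (hN : 3 ≤ N) {s : ℕ → K} {a : K}
    (h : ∀ n : ℕ, N - 3 ≤ n → s n = a * ((n : K) ^ 2 + 7 * (n : K) + 6) - 2 * ((n : K) + 1)) :
    SolvesRecurrenceFrom N s := by
  intro n hn
  obtain ⟨m, rfl⟩ : ∃ m, n = m + 3 := ⟨n - 3, by omega⟩
  have hne : (m : K) + 1 ≠ 0 := Nat.cast_add_one_ne_zero m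
  have hc : ((m + 3 : ℕ) : K) - 2 = m + 1 := by push_cast; ring
  simp only [Nat.add_sub_cancel, hc, show m + 3 - 1 = m + 2 by omega]
  rw [h (m + 3) (by omega), h (m + 2) (by omega), h m (by omega)]
  push_cast
  field_simp
  ring

theorem isHypergeometric_of_eventually_eq_eval {s : ℕ → K} {p : K[X]} (hp : p ≠ 0)
    (h : ∀ᶠ n : ℕ in atTop, s n = p.eval (n : K)) : IsHypergeometric s := by
  refine ⟨algebraMap K[X] (RatFunc K) (taylor 1 p) / algebraMap K[X] (RatFunc K) p, ?_⟩
  set x : RatFunc K :=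
    algebraMap K[X] (RatFunc K) (taylor 1 p) / algebraMap K[X] (RatFunc K) p with hx
  have hnd : x.num * p = taylor 1 p * x.denom := (RatFunc.num_mul_eq_mul_denom_iff hp).mpr hx
  filter_upwards [h, (tendsto_add_atTop_nat 1).eventually h,
    eventually_eval_natCast_ne_zero x.denom_ne_zero] with n h0 h1 hd
  have hev := congrArg (eval (n : K)) hnd
  simp only [eval_mul, taylor_eval] at hev
  push_cast at h1
  rw [h1, h0, RatFunc.eval, eval₂_id, eval₂_id, div_mul_eq_mul_div, hev, mul_div_cancel_right₀ _ hd]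

theorem IsHypergeometric.exists_eval_mul_eq {s : ℕ → K} (hs : IsHypergeometric s) :
    ∃ p q : K[X], q ≠ 0 ∧ ∀ᶠ n : ℕ in atTop, q.eval (n : K) * s (n + 1) = p.eval (n : K) * s n := by
  obtain ⟨r, hr⟩ := hs
  refine ⟨r.num, r.denom, r.denom_ne_zero, ?_⟩
  filter_upwards [hr, eventually_eval_natCast_ne_zero r.denom_ne_zero] with n hn hne
  rw [hn, RatFunc.eval, eval₂_id, eval₂_id]
  field_simp

/-- A hypergeometric solution of the recurrence is eventually a rational function of the index. -/
theorem SolvesRecurrenceFrom.exists_coprime {N : ℕ} {s : ℕ → K} (hs : SolvesRecurrenceFrom N s)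
    (hh : IsHypergeometric s) :
    ∃ A B : K[X], B ≠ 0 ∧ IsCoprime A B ∧
      ∀ᶠ n : ℕ in atTop, B.eval (n : K) * s n = A.eval (n : K) := by
  classical
  obtain ⟨p, q, hq, hpq⟩ := hh.exists_eval_mul_eq
  have htq : ∀ r : K, taylor r q ≠ 0 := fun r h0 => hq (taylor_injective r (by simpa using h0))
  have hX : (X + 1 : K[X]) ≠ 0 := by
    simpa using X_add_C_ne_zero (1 : K)
  -- `B * s = A` is the cleared recurrence times `q(n) q(n+1) q(n+2)`, with later terms reduced to
  -- `s n`; `A` is the inhomogeneous part.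
  set A : K[X] := 2 * (X + 1) * q * taylor 1 q * taylor 2 q with hA
  set B : K[X] := (X + 1) * (taylor 2 p * taylor 1 p * p - taylor 2 q * taylor 1 p * p)
    - 2 * q * taylor 1 q * taylor 2 q with hB
  have hA0 : A ≠ 0 := by
    simp only [hA, ne_eq, mul_eq_zero, hX, hq, htq, or_false]
    exact two_ne_zero
  have hAB : ∀ᶠ n : ℕ in atTop, B.eval (n : K) * s n = A.eval (n : K) := by
    filter_upwards [hpq, (tendsto_add_atTop_nat 1).eventually hpq,
      (tendsto_add_atTop_nat 2).eventually hpq, eventually_ge_atTop N] with n h0 h1 h2 hn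
    have hrec := hs.mul_eq (n := n) (by omega)
    simp only [hA, hB, eval_mul, eval_sub, eval_add, eval_X, eval_one, eval_ofNat, taylor_eval]
    push_cast at h1 h2
    set Q0 := q.eval (n : K)
    set Q1 := q.eval ((n : K) + 1)
    set Q2 := q.eval ((n : K) + 2)
    set P0 := p.eval (n : K)
    set P1 := p.eval ((n : K) + 1)
    set P2 := p.eval ((n : K) + 2)
    linear_combination Q0 * Q1 * Q2 * hrec - ((n : K) + 1) * Q0 * Q1 * h2
      - ((n : K) + 1) * (P2 - Q2) * Q0 * h1 - ((n : K) + 1) * (P2 - Q2) * P1 * h0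
  have hB0 : B ≠ 0 := by
    intro h0
    obtain ⟨n, hn, hn'⟩ := (hAB.and (eventually_eval_natCast_ne_zero hA0)).exists
    exact hn' (by simpa [h0] using hn.symm)
  clear_value A B
  have hg : EuclideanDomain.gcd A B ≠ 0 := fun h0 => hB0 (EuclideanDomain.gcd_eq_zero_iff.mp h0).2
  obtain ⟨A', hA'⟩ := EuclideanDomain.gcd_dvd_left A B
  obtain ⟨B', hB'⟩ := EuclideanDomain.gcd_dvd_right A B
  refine ⟨A', B', ?_, ?_, ?_⟩
  · rintro rfl
    exact hB0 (by simpa using hB')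
  · refine ⟨EuclideanDomain.gcdA A B, EuclideanDomain.gcdB A B, mul_left_cancel₀ hg ?_⟩
    have hbez := EuclideanDomain.gcd_eq_gcd_ab A B
    generalize EuclideanDomain.gcd A B = g at *
    linear_combination -hbez - EuclideanDomain.gcdA A B * hA' - EuclideanDomain.gcdB A B * hB'
  · filter_upwards [hAB, eventually_eval_natCast_ne_zero hg] with n hn hne
    have eA := congrArg (eval (n : K)) hA'
    have eB := congrArg (eval (n : K)) hB'
    rw [eval_mul] at eA eB
    exact mul_left_cancel₀ hne (by linear_combination hn + eA - s n * eB)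

/-- A hypergeometric solution of the recurrence is eventually a polynomial in the index. -/
theorem SolvesRecurrenceFrom.exists_eventually_eq_eval {N : ℕ} {s : ℕ → K}
    (hs : SolvesRecurrenceFrom N s) (hh : IsHypergeometric s) :
    ∃ p : K[X], ∀ᶠ n : ℕ in atTop, s n = p.eval (n : K) := by
  obtain ⟨A, B, hB, hcop, hAB⟩ := hs.exists_coprime hh
  have hid : (X + 1) * (taylor 3 A * taylor 2 B - taylor 2 A * taylor 3 B) * B
      = (2 * A + 2 * (X + 1) * B) * (taylor 2 B * taylor 3 B) := by
    apply eq_of_eventually_eval_natCast_eq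
    filter_upwards [hAB, (tendsto_add_atTop_nat 2).eventually hAB,
      (tendsto_add_atTop_nat 3).eventually hAB, eventually_ge_atTop N] with n h0 h2 h3 hn
    have hrec := hs.mul_eq (n := n) (by omega)
    simp only [eval_mul, eval_sub, eval_add, eval_X, eval_one, eval_ofNat, taylor_eval]
    push_cast at h2 h3
    rw [← h0, ← h2, ← h3]
    linear_combination B.eval (n : K) * B.eval ((n : K) + 2) * B.eval ((n : K) + 3) * hrec
  have hdvd : B ∣ taylor 2 B * taylor 3 B := by
    have h2 : B ∣ 2 * A * (taylor 2 B * taylor 3 B) :=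
      ⟨(X + 1) * (taylor 3 A * taylor 2 B - taylor 2 A * taylor 3 B)
        - 2 * (X + 1) * (taylor 2 B * taylor 3 B), by linear_combination -hid⟩
    have hunit : IsUnit (2 : K[X]) := by
      exact isUnit_C.mpr (IsUnit.mk0 (2 : K) two_ne_zero)
    have h3 : IsCoprime B (2 * A) := (isCoprime_mul_unit_left_right hunit B A).mpr hcop.symm
    exact h3.dvd_of_dvd_mul_left h2
  have hdeg : B.natDegree = 0 :=
    natDegree_eq_zero_of_dvd_taylor_mul_taylor hB (a := 2) (b := 3) two_pos three_pos
      (by exact_mod_cast hdvd)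
  obtain ⟨c, rfl⟩ := natDegree_eq_zero.mp hdeg
  have hc : c ≠ 0 := by simpa using hB
  refine ⟨C c⁻¹ * A, ?_⟩
  filter_upwards [hAB] with n hn
  rw [eval_mul, ← hn, eval_C, eval_C, inv_mul_cancel_left₀ hc]

end Recurrence

theorem proposition3p7 {K : Type*} [Field K] [CharZero K] (N : ℕ) (hN : 3 ≤ N) (s : ℕ → K) :
    (SolvesRecurrenceFrom N s ∧ IsHypergeometric s) ↔
      ∃ a : K, ∀ n : ℕ, N - 3 ≤ n →
        s n = a * ((n : K) ^ 2 + 7 * (n : K) + 6) - 2 * ((n : K) + 1) := by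
  constructor
  · rintro ⟨hs, hh⟩
    obtain ⟨p, hp⟩ := hs.exists_eventually_eq_eval hh
    have hid : (X + 1) * (taylor 3 p - taylor 2 p) = 2 * p + 2 * (X + 1) := by
      apply eq_of_eventually_eval_natCast_eq
      filter_upwards [hp, (tendsto_add_atTop_nat 2).eventually hp,
        (tendsto_add_atTop_nat 3).eventually hp, eventually_ge_atTop N] with n h0 h2 h3 hn
      have hrec := hs.mul_eq (n := n) (by omega)
      rw [h0, h2, h3] at hrec
      simpa [taylor_eval] using hrec
    obtain ⟨a, ha⟩ := exists_eval_eq_of_recurrence hid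
    exact ⟨a, hs.eq_of_eventuallyEq
      (solvesRecurrenceFrom_of_eq_quadratic hN (a := a) fun n _ => rfl)
      (hp.mono fun n hn => hn.trans (ha n))⟩
  · rintro ⟨a, ha⟩
    refine ⟨solvesRecurrenceFrom_of_eq_quadratic hN ha, ?_⟩
    refine isHypergeometric_of_eventually_eq_eval
      (p := C a * (X ^ 2 + 7 * X + 6) - 2 * (X + 1)) ?_ ?_
    · intro h0
      -- `-6` is a root of `X ^ 2 + 7 * X + 6` but not of `X + 1`, so the value is nonzero for every
      -- `a`.
      have h1 := congrArg (eval (-6)) h0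
      norm_num at h1
    · filter_upwards [eventually_ge_atTop (N - 3)] with n hn
      simp [ha n hn]
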